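/- Let $\mathbb K\in\{\mathbb R,\mathbb C,\mathbb H\}$, let $\delta=\dim_{\mathbb R}\mathbb K\in\{1,2,4\}$, let $m\ge 2$ be an integer, and put $$\alpha=\frac{\delta(m-1)-2}{2},\qquad \beta=\frac{\delta-2}{2},\qquad \lambda_{\mathbb K}(m)=\begin{cases}2^{m-1}(m-1)!,&\mathbb K=\mathbb R,\\ 2^{4(m-1)}\,((m-1)!)^2,&\mathbb K=\mathbb C,\\ 2^{8(m-1)}(2m-1)!\,(2m-2)!,&\mathbb K=\mathbb H.\end{cases}$$ For $\nu>0$ let $J_\nu(x)=\sum_{k\ge0}\frac{(-1)^k}{k!\,\Gamma(k+\nu+1)}\left(\frac x2\right)^{2k+\nu}$ $(x>0)$ be the Bessel function of the first kind, and let $j_{\nu,1}$ be its smallest positive zero. Then $j_{\alpha+1,1}$ exists, and $$j_{\alpha+1,1}^{\,\delta(m-1)}<\frac{\Gamma(\alpha+2)\Gamma(\beta+1)}{\Gamma(\alpha+\beta+2)}\,\lambda_{\mathbb K}(m),$$ except in the case $m=2$, $\delta=1$, when the two sides are equal. Consequently, for every even $p\ge 2$, $$\frac{p^{\delta(m-1)}}{\lambda_{\mathbb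 K}(m)}<\frac{\Gamma(\alpha+2)\Gamma(\beta+1)}{\Gamma(\alpha+\beta+2)}\cdot\frac{p^{\delta(m-1)}}{j_{\alpha+1,1}^{\,\delta(m-1)}},$$ except in the case $m=2$, $\delta=1$, when the two sides are equal. (The left and the right side are the leading terms, as $p\to\infty$, of the classical linear programming lower bound and of the new lower bound for the number of nodes of a projective cubature formula of index $p$ over $\mathbb K^m$.) -/

import Mathlib

open scoped Nat

noncomputable section

namespace ProjCubature

/-- The three base fields `ℝ`, `ℂ`, `ℍ`. -/
inductive BaseField where
  | real
  | complex
  | quaternion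

/-- `δ(K)`, the real dimension of the base field. -/
def BaseField.delta : BaseField → ℕ
  | .real => 1
  | .complex => 2
  | .quaternion => 4

/-- `α = (δ(m-1) - 2) / 2`. -/
def alpha (K : BaseField) (m : ℕ) : ℝ := ((K.delta : ℝ) * ((m : ℝ) - 1) - 2) / 2

/-- `β = (δ - 2) / 2`. -/
def beta (K : BaseField) : ℝ := ((K.delta : ℝ) - 2) / 2

/-- The constant `λ_K(m)` for `m ≥ 2`. -/
def lam (K : BaseField) (m : ℕ) : ℝ :=
  match K with
  | .real => 2 ^ (m - 1) * ((m - 1)! : ℝ)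
  | .complex => 2 ^ (4 * (m - 1)) * ((m - 1)! : ℝ) ^ 2
  | .quaternion => 2 ^ (8 * (m - 1)) * ((2 * m - 1)! : ℝ) * ((2 * m - 2)! : ℝ)

/-- The Bessel function of the first kind `J_ν(x)`, for real order `ν` and real `x > 0`:
`J_ν(x) = ∑_k (-1)^k / (k! Γ(k + ν + 1)) (x/2)^(2k + ν)`. Only arguments `x > 0` are used. -/
def besselJ (ν x : ℝ) : ℝ :=
  ∑' k : ℕ, (-1 : ℝ) ^ k / ((k ! : ℝ) * Real.Gamma ((k : ℝ) + ν + 1))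
    * (x / 2) ^ (2 * (k : ℝ) + ν)

/-- The set of positive zeros of `J_ν`. -/
def besselPosZeros (ν : ℝ) : Set ℝ := {x : ℝ | 0 < x ∧ besselJ ν x = 0}

/-- `j_{ν,1}`, the first positive zero of `J_ν`. -/
def besselFirstZero (ν : ℝ) : ℝ := sInf (besselPosZeros ν)

/-- The factor `Γ(α+2) Γ(β+1) / Γ(α+β+2)`. -/
def gammaFactor (K : BaseField) (m : ℕ) : ℝ :=
  Real.Gamma (alpha K m + 2) * Real.Gamma (beta K + 1) / Real.Gamma (alpha K m + beta K + 2)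

/-- Leading term, as `p → ∞`, of the classical linear programming lower bound for the number of
nodes of a projective cubature formula of index `p`. -/
def classicalAsymptoticBound (K : BaseField) (m p : ℕ) : ℝ :=
  (p : ℝ) ^ (K.delta * (m - 1)) / lam K m

/-- Leading term, as `p → ∞`, of the new lower bound for the number of nodes. -/
def newAsymptoticBound (K : BaseField) (m p : ℕ) : ℝ :=
  gammaFactor K m *
    ((p : ℝ) ^ (K.delta * (m - 1)) / besselFirstZero (alpha K m + 1) ^ (K.delta * (m - 1)))

end ProjCubature

end

open scoped Nat

open Set Filter Topology

namespace ProjCubature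

/-! Put `d = δ(m-1)` and `ν = α + 1 = d/2`. For all three fields the right side collapses to `4^d
Γ(ν+1)²` (`gamma_mul_lam`), so everything reduces to `j_{ν,1}^d < 4^d Γ(ν+1)²` for `d ≥ 2`; for `d =
1` both sides are `π`, since `J_{1/2}` is a multiple of `sin x / √x`.

In the variable `t = x²/4`, `J_ν` becomes an entire function `E_ν` with `t E'' + (ν+1) E' + E = 0`
and `E_ν(0) > 0`. A Sturm comparison with `(T - t)²` forces a zero before `T = (ν+2)²/2`
(`exists_besselEntire_eq_zero`), so `j² < 2(ν+2)²`. For `d ≥ 4` this suffices, because `((ν+2)²/8)^ν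
≤ Γ(ν+1)²`, proved by induction `ν → ν + 1` (`mul_log_step`). For `d = 2, 3` it is too weak, and a
partial sum of the series shows directly that `E_ν` is negative at a suitable point. -/

/-! ### The normalized Bessel series, its derivative and its recurrence -/

/-- The coefficient `1 / (k! Γ(k + ν + 1))` of the normalized Bessel series. -/
noncomputable def besselCoeff (ν : ℝ) (k : ℕ) : ℝ :=
  1 / ((k ! : ℝ) * Real.Gamma ((k : ℝ) + ν + 1))

/-- The entire function `∑ₖ (-t)ᵏ / (k! Γ(k + ν + 1))`, for which
`J_ν(x) = (x/2)^ν * besselEntire ν (x²/4)`. -/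
noncomputable def besselEntire (ν t : ℝ) : ℝ := ∑' k : ℕ, (-t) ^ k * besselCoeff ν k

lemma besselCoeff_pos {ν : ℝ} (hν : 0 ≤ ν) (k : ℕ) : 0 < besselCoeff ν k := by
  have : 0 < Real.Gamma ((k : ℝ) + ν + 1) := Real.Gamma_pos_of_pos (by positivity)
  unfold besselCoeff
  positivity

lemma succ_mul_besselCoeff_succ (ν : ℝ) (k : ℕ) :
    ((k : ℝ) + 1) * besselCoeff ν (k + 1) = besselCoeff (ν + 1) k := by
  have h : ((k + 1 : ℕ) : ℝ) + ν + 1 = (k : ℝ) + (ν + 1) + 1 := by push_cast; ring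
  unfold besselCoeff
  rw [h, Nat.factorial_succ]
  push_cast
  have hk : (k : ℝ) + 1 ≠ 0 := by positivity
  rw [mul_assoc, one_div, mul_inv, ← mul_assoc, mul_inv_cancel₀ hk, one_mul, one_div]

lemma besselCoeff_eq_mul {ν : ℝ} (hν : 0 ≤ ν) (k : ℕ) :
    besselCoeff ν k = ((k : ℝ) + ν + 1) * besselCoeff (ν + 1) k := by
  have h0 : (k : ℝ) + ν + 1 ≠ 0 := by positivity
  have h : (k : ℝ) + (ν + 1) + 1 = ((k : ℝ) + ν + 1) + 1 := by ring
  unfold besselCoeff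
  rw [h, Real.Gamma_add_one h0]
  have : Real.Gamma ((k : ℝ) + ν + 1) ≠ 0 := (Real.Gamma_pos_of_pos (by positivity)).ne'
  field_simp

lemma besselCoeff_succ {ν : ℝ} (hν : 0 ≤ ν) (k : ℕ) :
    besselCoeff ν (k + 1) = besselCoeff ν k / (((k : ℝ) + 1) * ((k : ℝ) + ν + 1)) := by
  rw [besselCoeff_eq_mul hν k, ← succ_mul_besselCoeff_succ]
  have h0 : (k : ℝ) + ν + 1 ≠ 0 := by positivity
  field_simp

lemma besselCoeff_zero (ν : ℝ) : besselCoeff ν 0 = 1 / Real.Gamma (ν + 1) := by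
  simp [besselCoeff]

lemma besselCoeff_le {ν : ℝ} (hν : 0 ≤ ν) (k : ℕ) :
    besselCoeff ν k ≤ besselCoeff ν 0 / (k ! : ℝ) := by
  induction k with
  | zero => simp
  | succ k ih =>
    rw [besselCoeff_succ hν, Nat.factorial_succ]
    have h0 := besselCoeff_pos hν 0
    have h1 : (1 : ℝ) ≤ (k : ℝ) + ν + 1 := by
      have : (0 : ℝ) ≤ k := Nat.cast_nonneg k
      linarith
    have hk : (0 : ℝ) < (k : ℝ) + 1 := by positivity
    calc besselCoeff ν k / (((k : ℝ) + 1) * ((k : ℝ) + ν + 1))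
        ≤ (besselCoeff ν 0 / (k ! : ℝ)) / (((k : ℝ) + 1) * 1) := by gcongr
      _ = besselCoeff ν 0 / ((k + 1 : ℕ) * (k ! : ℕ) : ℕ) := by
        push_cast
        field_simp

lemma norm_besselEntire_term_le {ν : ℝ} (hν : 0 ≤ ν) {t R : ℝ} (ht : |t| ≤ R) (k : ℕ) :
    ‖(-t) ^ k * besselCoeff ν k‖ ≤ besselCoeff ν 0 * (R ^ k / (k ! : ℝ)) := by
  have hR : 0 ≤ R := (abs_nonneg t).trans ht
  rw [norm_mul, norm_pow, norm_neg, Real.norm_eq_abs, Real.norm_eq_abs,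
    abs_of_pos (besselCoeff_pos hν k)]
  calc |t| ^ k * besselCoeff ν k ≤ R ^ k * (besselCoeff ν 0 / (k ! : ℝ)) := by
        have := (besselCoeff_pos hν k).le
        have := besselCoeff_le hν k
        gcongr
    _ = _ := by ring

lemma summable_besselEntire {ν : ℝ} (hν : 0 ≤ ν) (t : ℝ) :
    Summable fun k : ℕ => (-t) ^ k * besselCoeff ν k :=
  Summable.of_norm_bounded ((Real.summable_pow_div_factorial |t|).mul_left (besselCoeff ν 0))
    (norm_besselEntire_term_le hν le_rfl)

lemma besselEntire_zero (ν : ℝ) : besselEntire ν 0 = 1 / Real.Gamma (ν + 1) := by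
  unfold besselEntire
  rw [tsum_eq_single 0]
  · simp [besselCoeff_zero]
  · intro k hk
    simp [hk]

lemma natCast_mul_pow_pred_mul_besselCoeff_succ (ν t : ℝ) (k : ℕ) :
    ((k + 1 : ℕ) : ℝ) * (-t) ^ k * besselCoeff ν (k + 1) = (-t) ^ k * besselCoeff (ν + 1) k := by
  rw [← succ_mul_besselCoeff_succ]
  push_cast
  ring

/-- `besselEntire ν` has derivative `-besselEntire (ν + 1)`. -/
lemma hasDerivAt_besselEntire {ν : ℝ} (hν : 0 ≤ ν) (t : ℝ) :
    HasDerivAt (besselEntire ν) (-besselEntire (ν + 1) t) t := by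
  set R := |t| + 1
  have hν' : 0 ≤ ν + 1 := by positivity
  let g' : ℕ → ℝ → ℝ := fun k s => -((k : ℝ) * (-s) ^ (k - 1) * besselCoeff ν k)
  -- Differentiation kills the constant term, and what remains is the series of order `ν + 1`
  -- shifted by one index; hence the `0` in front of the majorant.
  let u : ℕ → ℝ := fun k => Nat.casesOn k 0
    fun j => besselCoeff (ν + 1) 0 * (R ^ j / (j ! : ℝ))
  have hu : Summable u :=
    (summable_nat_add_iff 1).1 ((Real.summable_pow_div_factorial R).mul_left _)
  have hg : ∀ (k : ℕ), ∀ s ∈ Metric.ball (0 : ℝ) R,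
      HasDerivAt (fun s : ℝ => (-s) ^ k * besselCoeff ν k) (g' k s) s := by
    intro k s _
    have := ((hasDerivAt_neg s).pow k).mul_const (besselCoeff ν k)
    refine this.congr_deriv ?_
    simp only [g']
    ring
  have hbound : ∀ (k : ℕ), ∀ s ∈ Metric.ball (0 : ℝ) R, ‖g' k s‖ ≤ u k := by
    intro k s hs
    cases k with
    | zero => simp [g', u]
    | succ j =>
      simp only [g', u, norm_neg, Nat.add_sub_cancel]
      rw [natCast_mul_pow_pred_mul_besselCoeff_succ]
      refine norm_besselEntire_term_le hν' ?_ j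
      simpa using (mem_ball_zero_iff.1 hs).le
  have htR : t ∈ Metric.ball (0 : ℝ) R := by
    rw [mem_ball_zero_iff, Real.norm_eq_abs]
    exact lt_add_one _
  have key := hasDerivAt_tsum_of_isPreconnected hu Metric.isOpen_ball
    (convex_ball (0 : ℝ) R).isPreconnected hg hbound htR (summable_besselEntire hν t) htR
  refine key.congr_deriv ?_
  have hs : Summable fun k => g' k t := Summable.of_norm_bounded hu fun k => hbound k t htR
  rw [hs.tsum_eq_zero_add]
  simp only [g', Nat.add_sub_cancel, natCast_mul_pow_pred_mul_besselCoeff_succ, tsum_neg]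
  simp [besselEntire]

lemma continuous_besselEntire {ν : ℝ} (hν : 0 ≤ ν) : Continuous (besselEntire ν) :=
  continuous_iff_continuousAt.2 fun t => (hasDerivAt_besselEntire hν t).continuousAt

/-- The three-term recurrence of the Bessel functions. -/
lemma besselEntire_recurrence {ν : ℝ} (hν : 0 ≤ ν) (t : ℝ) :
    besselEntire ν t - (ν + 1) * besselEntire (ν + 1) t + t * besselEntire (ν + 2) t = 0 := by
  have hν1 : 0 ≤ ν + 1 := by positivity
  have h0 := summable_besselEntire hν t
  have h1 := summable_besselEntire hν1 t
  have hd : ∀ k : ℕ, (-t) ^ k * besselCoeff ν k - (ν + 1) * ((-t) ^ k * besselCoeff (ν + 1) k)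
      = (-t) ^ k * ((k : ℝ) * besselCoeff (ν + 1) k) := by
    intro k
    rw [besselCoeff_eq_mul hν k]
    ring
  have hs := h0.sub (h1.mul_left (ν + 1))
  have e : besselEntire ν t - (ν + 1) * besselEntire (ν + 1) t
      = ∑' k : ℕ, (-t) ^ k * ((k : ℝ) * besselCoeff (ν + 1) k) := by
    unfold besselEntire
    rw [← tsum_mul_left, ← h0.tsum_sub (h1.mul_left _)]
    exact tsum_congr hd
  have hs' : Summable fun k : ℕ => (-t) ^ k * ((k : ℝ) * besselCoeff (ν + 1) k) :=
    hs.congr hd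
  have e2 : ∀ k : ℕ, (-t) ^ (k + 1) * (((k + 1 : ℕ) : ℝ) * besselCoeff (ν + 1) (k + 1))
      = -t * ((-t) ^ k * besselCoeff (ν + 2) k) := by
    intro k
    have h := succ_mul_besselCoeff_succ (ν + 1) k
    rw [show ν + 1 + 1 = ν + 2 by ring] at h
    rw [← h]
    push_cast
    ring
  rw [e, hs'.tsum_eq_zero_add, tsum_congr e2, tsum_mul_left]
  simp [besselEntire]

/-! ### From zeros of the entire function to the first Bessel zero -/

lemma besselJ_eq {ν x : ℝ} (hx : 0 < x) :
    besselJ ν x = (x / 2) ^ ν * besselEntire ν (x ^ 2 / 4) := by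
  unfold besselJ besselEntire
  rw [← tsum_mul_left]
  refine tsum_congr fun k => ?_
  have h2 : 0 < x / 2 := by positivity
  rw [Real.rpow_add h2, mul_comm (2 : ℝ), Real.rpow_mul h2.le, Real.rpow_natCast,
    show (2 : ℝ) = ((2 : ℕ) : ℝ) by norm_num, Real.rpow_natCast, ← pow_mul, mul_comm k 2, pow_mul,
    neg_pow (x ^ 2 / _)]
  unfold besselCoeff
  push_cast
  rw [show (x / 2) ^ 2 = x ^ 2 / 4 by ring]
  ring

lemma besselPosZeros_eq (ν : ℝ) :
    besselPosZeros ν = {x : ℝ | 0 < x ∧ besselEntire ν (x ^ 2 / 4) = 0} := by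
  ext x
  refine and_congr_right fun hx => ?_
  rw [besselJ_eq hx, mul_eq_zero, or_iff_right]
  exact (Real.rpow_pos_of_pos (by positivity) ν).ne'

/-- A positive zero of `besselEntire ν` yields the existence of `j_{ν,1}` and a bound on it. -/
lemma besselFirstZero_of_zero {ν t : ℝ} (hν : 0 ≤ ν) (ht : 0 < t) (h : besselEntire ν t = 0) :
    IsLeast (besselPosZeros ν) (besselFirstZero ν) ∧ besselFirstZero ν ^ 2 ≤ 4 * t := by
  have hmem : 2 * √t ∈ besselPosZeros ν := by
    rw [besselPosZeros_eq]
    refine ⟨by positivity, ?_⟩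
    rwa [mul_pow, Real.sq_sqrt ht.le, show (2 : ℝ) ^ 2 * t / 4 = t by ring]
  have hbdd : BddBelow (besselPosZeros ν) := ⟨0, fun x hx => hx.1.le⟩
  -- Since `E_ν(0) ≠ 0`, the condition `0 < x` may be relaxed to `0 ≤ x`, which is closed; the
  -- infimum is then attained.
  have hclosed : IsClosed (besselPosZeros ν) := by
    have : besselPosZeros ν
        = {x : ℝ | 0 ≤ x} ∩ (fun x : ℝ => besselEntire ν (x ^ 2 / 4)) ⁻¹' {0} := by
      rw [besselPosZeros_eq]
      ext x
      refine ⟨fun hx => ⟨hx.1.le, hx.2⟩, fun hx => ⟨lt_of_le_of_ne hx.1 ?_, hx.2⟩⟩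
      rintro rfl
      have h0 : besselEntire ν ((0 : ℝ) ^ 2 / 4) = 0 := hx.2
      have : 0 < Real.Gamma (ν + 1) := Real.Gamma_pos_of_pos (by positivity)
      rw [show (0 : ℝ) ^ 2 / 4 = 0 by norm_num, besselEntire_zero] at h0
      exact absurd h0 (by positivity)
    rw [this]
    refine isClosed_Ici.inter (isClosed_singleton.preimage ?_)
    exact (continuous_besselEntire hν).comp (by fun_prop)
  have hleast : IsLeast (besselPosZeros ν) (besselFirstZero ν) :=
    ⟨hclosed.csInf_mem ⟨_, hmem⟩ hbdd, fun x hx => csInf_le hbdd hx⟩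
  refine ⟨hleast, ?_⟩
  have h1 := hleast.2 hmem
  have h2 : 0 < besselFirstZero ν := hleast.1.1
  calc besselFirstZero ν ^ 2 ≤ (2 * √t) ^ 2 := by gcongr
    _ = 4 * t := by rw [mul_pow, Real.sq_sqrt ht.le]; norm_num

/-! ### Upper bounds for the first zero -/

/-- If `besselEntire ν` has no zero in `(0, T)`, then it is positive there. -/
lemma besselEntire_pos_of_forall_ne_zero {ν T : ℝ} (hν : 0 ≤ ν)
    (h : ∀ t ∈ Ioo 0 T, besselEntire ν t ≠ 0) {t : ℝ} (ht : t ∈ Ioo 0 T) :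
    0 < besselEntire ν t := by
  by_contra hneg
  have h0 : 0 < besselEntire ν 0 := by
    have : 0 < Real.Gamma (ν + 1) := Real.Gamma_pos_of_pos (by positivity)
    rw [besselEntire_zero]
    positivity
  obtain ⟨s, hs, hs0⟩ := intermediate_value_Icc' ht.1.le
    (continuous_besselEntire hν).continuousOn ⟨not_lt.1 hneg, h0.le⟩
  refine h s ⟨lt_of_le_of_ne hs.1 ?_, hs.2.trans_lt ht.2⟩ hs0
  rintro rfl
  exact h0.ne' hs0

/-- A Sturm comparison with the test function `(T - t)²` gives `j_{ν,1}² < 2 (ν + 2)²`. -/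
lemma exists_besselEntire_eq_zero {ν : ℝ} (hν : 0 ≤ ν) :
    ∃ t ∈ Ioo 0 ((ν + 2) ^ 2 / 2), besselEntire ν t = 0 := by
  by_contra! hne
  set T := (ν + 2) ^ 2 / 2 with hT
  have hν1 : 0 ≤ ν + 1 := by positivity
  have hT0 : 0 < T := by positivity
  have hpos : ∀ t ∈ Ioo 0 T, 0 < besselEntire ν t :=
    fun t ht => besselEntire_pos_of_forall_ne_zero hν hne ht
  -- The weighted Wronskian `t^(ν+1) (E' y - E y')` with `y = (T - t)²`. With `s = T - t`, its
  -- derivative is `-t^ν E (s² - 2(ν+2)s + 2T)`, and `T` is the value that makes this quadratic a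
  -- perfect square.
  let G : ℝ → ℝ := fun t => t ^ (ν + 1) *
    (-besselEntire (ν + 1) t * (T - t) ^ 2 + besselEntire ν t * (2 * (T - t)))
  have hG : ∀ t ∈ Ioo 0 T,
      HasDerivAt G (-(t ^ ν * besselEntire ν t * (T - t - (ν + 2)) ^ 2)) t := by
    intro t ht
    have d0 := hasDerivAt_besselEntire hν t
    have d1 := hasDerivAt_besselEntire hν1 t
    rw [show ν + 1 + 1 = ν + 2 by ring] at d1
    have dl : HasDerivAt (fun s => T - s) (-1) t := by
      simpa using (hasDerivAt_id t).const_sub T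
    have dp : HasDerivAt (fun s : ℝ => s ^ (ν + 1)) ((ν + 1) * t ^ ν) t := by
      simpa using Real.hasDerivAt_rpow_const (p := ν + 1) (Or.inl ht.1.ne')
    have d := dp.mul ((d1.neg.mul (dl.pow 2)).add (d0.mul (dl.const_mul 2)))
    refine d.congr_deriv ?_
    -- As `E_ν' = -E_{ν+1}`, the recurrence is the Bessel differential equation.
    have hr := besselEntire_recurrence hν t
    have hp : t ^ (ν + 1) = t ^ ν * t := by rw [Real.rpow_add ht.1, Real.rpow_one]
    simp only [Pi.mul_apply, Pi.add_apply, Pi.neg_apply, Pi.pow_apply, hp]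
    push_cast
    simp only [hT]
    linear_combination (t ^ ν * ((ν + 2) ^ 2 / 2 - t) ^ 2) * hr
  have hcont : ContinuousOn G (Icc 0 T) := by
    have h0 := continuous_besselEntire hν
    have h1 := continuous_besselEntire hν1
    have h2 : Continuous fun t : ℝ => t ^ (ν + 1) := Real.continuous_rpow_const hν1
    exact Continuous.continuousOn (by fun_prop)
  have hanti : AntitoneOn G (Icc 0 T) := by
    refine antitoneOn_of_deriv_nonpos (convex_Icc 0 T) hcont ?_ ?_
    · rw [interior_Icc]
      exact fun t ht => (hG t ht).differentiableAt.differentiableWithinAt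
    · rw [interior_Icc]
      intro t ht
      rw [(hG t ht).deriv]
      have := (hpos t ht).le
      have := Real.rpow_nonneg ht.1.le ν
      exact neg_nonpos.2 (by positivity)
  have hG0 : G 0 = 0 := by
    simp only [G]
    rw [Real.zero_rpow (by positivity), zero_mul]
  have hGT : G T = 0 := by simp [G]
  have hGz : ∀ t ∈ Ioo 0 T, G t = 0 := fun t ht =>
    le_antisymm (hG0 ▸ hanti (left_mem_Icc.2 hT0.le) (Ioo_subset_Icc_self ht) ht.1.le)
      (hGT ▸ hanti (Ioo_subset_Icc_self ht) (right_mem_Icc.2 hT0.le) ht.2.le)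
  -- `G` vanishes at both ends and is monotone, hence is zero; any interior point with `T - t ≠ ν +
  -- 2`, where `G'` is nonzero, gives a contradiction.
  have ht0 : T - (ν + 2) / 2 ∈ Ioo 0 T := ⟨by rw [hT]; nlinarith, by linarith⟩
  have hd := hG _ ht0
  have hev : G =ᶠ[𝓝 (T - (ν + 2) / 2)] fun _ => 0 := by
    filter_upwards [isOpen_Ioo.mem_nhds ht0] with t ht using hGz t ht
  have hzero := (hd.congr_of_eventuallyEq hev.symm).unique (hasDerivAt_const _ (0 : ℝ))
  have h1 := hpos _ ht0
  have h2 := Real.rpow_pos_of_pos ht0.1 ν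
  have h3 : T - (T - (ν + 2) / 2) - (ν + 2) ≠ 0 := by
    have : T - (T - (ν + 2) / 2) - (ν + 2) = -((ν + 2) / 2) := by ring
    rw [this]
    exact neg_ne_zero.2 (by positivity)
  have : 0 < (T - (T - (ν + 2) / 2) - (ν + 2)) ^ 2 := by positivity
  exact absurd hzero (neg_ne_zero.2 (by positivity))

/-- If the terms of the series decrease from the first one on, the sum of the first five terms
bounds the value from above. -/
lemma besselEntire_le_of_le {ν t : ℝ} (hν : 0 ≤ ν) (ht : 0 ≤ t) (h : t ≤ 2 * (ν + 2)) :
    besselEntire ν t ≤ ∑ k ∈ Finset.range 5, (-t) ^ k * besselCoeff ν k := by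
  -- The constant term is left out because the first ratio `t / (ν + 1)` may exceed `1`; the next
  -- one is `t / (2(ν + 2))`.
  let f : ℕ → ℝ := fun k => t ^ (k + 1) * besselCoeff ν (k + 1)
  have hanti : Antitone f := by
    refine antitone_nat_of_succ_le fun k => ?_
    have hk : (0 : ℝ) ≤ k := Nat.cast_nonneg k
    have hc := besselCoeff_pos hν (k + 1)
    simp only [f]
    rw [besselCoeff_succ hν (k + 1), pow_succ t (k + 1)]
    have hden : 0 < (((k + 1 : ℕ) : ℝ) + 1) * (((k + 1 : ℕ) : ℝ) + ν + 1) := by positivity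
    have hle : t ≤ (((k + 1 : ℕ) : ℝ) + 1) * (((k + 1 : ℕ) : ℝ) + ν + 1) := by
      push_cast
      nlinarith
    calc t ^ (k + 1) * t * (besselCoeff ν (k + 1) / _)
        = t ^ (k + 1) * besselCoeff ν (k + 1)
          * (t / ((((k + 1 : ℕ) : ℝ) + 1) * (((k + 1 : ℕ) : ℝ) + ν + 1))) := by ring
      _ ≤ t ^ (k + 1) * besselCoeff ν (k + 1) * 1 := by
        gcongr
        exact (div_le_one hden).2 hle
      _ = _ := mul_one _
  have hs := summable_besselEntire hν t
  have hsum : HasSum (fun k => (-1) ^ k * f k) (besselCoeff ν 0 - besselEntire ν t) := by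
    have h1 := ((hasSum_nat_add_iff' 1).2 hs.hasSum).neg
    have hf : ∀ k : ℕ, (-1) ^ k * f k = -((-t) ^ (k + 1) * besselCoeff ν (k + 1)) := by
      intro k
      simp only [f]
      rw [neg_pow t]
      ring
    rw [funext hf]
    have he : besselCoeff ν 0 - besselEntire ν t =
        -(besselEntire ν t - ∑ k ∈ Finset.range 1, (-t) ^ k * besselCoeff ν k) := by simp
    rw [he]
    exact h1
  have hb := hanti.alternating_series_le_tendsto hsum.tendsto_sum_nat 2
  simp only [Finset.sum_range_succ, Finset.sum_range_zero, f] at hb ⊢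
  ring_nf at hb ⊢
  linarith

lemma exists_besselEntire_eq_zero_of_neg {ν T : ℝ} (hν : 0 ≤ ν) (hT : 0 < T)
    (h : besselEntire ν T < 0) : ∃ t ∈ Ioo 0 T, besselEntire ν t = 0 := by
  have h0 : 0 < besselEntire ν 0 := by
    have : 0 < Real.Gamma (ν + 1) := Real.Gamma_pos_of_pos (by positivity)
    rw [besselEntire_zero]
    positivity
  exact intermediate_value_Ioo' hT.le (continuous_besselEntire hν).continuousOn ⟨h, h0⟩

lemma besselEntire_one_four_neg : besselEntire 1 4 < 0 := by
  refine (besselEntire_le_of_le zero_le_one (by norm_num) (by norm_num)).trans_lt ?_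
  have h0 := besselCoeff_pos (zero_le_one' ℝ) 0
  simp only [Finset.sum_range_succ, Finset.sum_range_zero, besselCoeff_succ (zero_le_one' ℝ)]
  norm_num
  linarith

lemma besselEntire_three_halves_neg : besselEntire (3 / 2) (28 / 5) < 0 := by
  have hν : (0 : ℝ) ≤ 3 / 2 := by norm_num
  refine (besselEntire_le_of_le hν (by norm_num) (by norm_num)).trans_lt ?_
  have h0 := besselCoeff_pos hν 0
  simp only [Finset.sum_range_succ, Finset.sum_range_zero, besselCoeff_succ hν]
  norm_num
  linarith

lemma besselFirstZero_lt_of_exists {ν T : ℝ} (hν : 0 ≤ ν)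
    (h : ∃ t ∈ Ioo 0 T, besselEntire ν t = 0) :
    IsLeast (besselPosZeros ν) (besselFirstZero ν) ∧ besselFirstZero ν ^ 2 < 4 * T := by
  obtain ⟨t, ht, h0⟩ := h
  obtain ⟨h1, h2⟩ := besselFirstZero_of_zero hν ht.1 h0
  exact ⟨h1, h2.trans_lt (by linarith [ht.2])⟩

/-! ### Order one half: the case of equality -/

/-- The duplication formula turns `k! Γ(k + 3/2)` into `(2k+1)! √π / 2^(2k+1)`, which gives the sine
series. -/
lemma besselJ_half {x : ℝ} (hx : 0 < x) :
    besselJ (1 / 2) x = (x / 2) ^ (1 / 2 : ℝ) * (2 / (√Real.pi * x)) * Real.sin x := by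
  rw [besselJ_eq hx, mul_assoc, ← (Real.hasSum_sin x).tsum_eq, ← tsum_mul_left]
  unfold besselEntire
  congr 1
  refine tsum_congr fun k => ?_
  have hg := Real.Gamma_mul_Gamma_add_half ((k : ℝ) + 1)
  rw [Real.Gamma_nat_eq_factorial, show 2 * ((k : ℝ) + 1) = ((2 * k + 1 : ℕ) : ℝ) + 1 by
      push_cast; ring, Real.Gamma_nat_eq_factorial,
    show 1 - (((2 * k + 1 : ℕ) : ℝ) + 1) = -((2 * k + 1 : ℕ) : ℝ) by ring,
    Real.rpow_neg (by norm_num), Real.rpow_natCast] at hg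
  unfold besselCoeff
  rw [show (k : ℝ) + 1 / 2 + 1 = (k : ℝ) + 1 + 1 / 2 by ring, hg, neg_pow, div_pow, ← pow_mul,
    show (4 : ℝ) ^ k = 2 ^ (2 * k) by rw [pow_mul]; norm_num]
  have hpi : √Real.pi ≠ 0 := by positivity
  field_simp
  ring

lemma besselFirstZero_half :
    IsLeast (besselPosZeros (1 / 2)) (besselFirstZero (1 / 2)) ∧
      besselFirstZero (1 / 2) = Real.pi := by
  have hl : IsLeast (besselPosZeros (1 / 2)) Real.pi := by
    refine ⟨⟨Real.pi_pos, by rw [besselJ_half Real.pi_pos, Real.sin_pi, mul_zero]⟩, ?_⟩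
    rintro x ⟨hx, h0⟩
    by_contra! hlt
    rw [besselJ_half hx] at h0
    have h1 := Real.sin_pos_of_pos_of_lt_pi hx hlt
    have h2 : 0 < (x / 2) ^ (1 / 2 : ℝ) := Real.rpow_pos_of_pos (by positivity) _
    exact absurd h0 (by positivity)
  have he : besselFirstZero (1 / 2) = Real.pi := hl.csInf_eq
  exact ⟨he ▸ hl, he⟩

/-! ### The Gamma function inequality -/

lemma log_le_half_sub_inv {y : ℝ} (hy : 1 ≤ y) : Real.log y ≤ (y - y⁻¹) / 2 := by
  rw [← Real.sinh_log (by positivity)]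
  exact Real.self_le_sinh_iff.2 (Real.log_nonneg hy)

/-- The trapezoidal rule overestimates the integral of the convex function `1/x`. -/
lemma log_add_one_sub_log_le {x : ℝ} (hx : 0 < x) :
    Real.log (x + 1) - Real.log x ≤ (1 / x + 1 / (x + 1)) / 2 := by
  rw [← Real.log_div (by positivity) hx.ne']
  refine (log_le_half_sub_inv ((one_le_div hx).2 (by linarith))).trans_eq ?_
  field_simp
  ring

lemma two_le_log_eight : 2 ≤ Real.log 8 := by
  rw [Real.le_log_iff_exp_le (by norm_num)]
  have h := Real.exp_one_lt_d9
  have h0 := Real.exp_pos 1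
  rw [show (2 : ℝ) = 1 + 1 by norm_num, Real.exp_add]
  nlinarith

/-- The step of the induction that compares `ν log ((ν + 2)² / 8)` with `2 log Γ(ν + 1)`. -/
lemma mul_log_step {ν : ℝ} (hν : 1 ≤ ν) :
    (ν + 1) * Real.log ((ν + 3) ^ 2 / 8) ≤
      ν * Real.log ((ν + 2) ^ 2 / 8) + 2 * Real.log (ν + 1) := by
  rw [Real.log_div (by positivity) (by norm_num), Real.log_div (by positivity) (by norm_num),
    Real.log_pow, Real.log_pow]
  push_cast
  have h1 := log_add_one_sub_log_le (show 0 < ν + 1 by positivity)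
  have h2 := log_add_one_sub_log_le (show 0 < ν + 2 by positivity)
  rw [show ν + 1 + 1 = ν + 2 by ring] at h1
  rw [show ν + 2 + 1 = ν + 3 by ring] at h2
  have h8 := two_le_log_eight
  -- After regrouping, the claim bounds twice `(ν+1) log((ν+3)/(ν+2)) + log((ν+2)/(ν+1))` by `log
  -- 8`; the trapezoidal bounds give at most `2`.
  have h3 : (ν + 1) * ((1 / (ν + 2) + 1 / (ν + 3)) / 2) + (1 / (ν + 1) + 1 / (ν + 2)) / 2 ≤ 1 := by
    have e : 1 - ((ν + 1) * ((1 / (ν + 2) + 1 / (ν + 3)) / 2)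
        + (1 / (ν + 1) + 1 / (ν + 2)) / 2) = (ν - 1) / (2 * (ν + 1) * (ν + 3)) := by
      field_simp
      ring
    have : 0 ≤ (ν - 1) / (2 * (ν + 1) * (ν + 3)) :=
      div_nonneg (by linarith) (by positivity)
    linarith
  have h4 : (ν + 1) * (Real.log (ν + 3) - Real.log (ν + 2))
      ≤ (ν + 1) * ((1 / (ν + 2) + 1 / (ν + 3)) / 2) := by gcongr
  linarith

lemma Gamma_five_halves : Real.Gamma (5 / 2) = 3 / 4 * √Real.pi := by
  have h := Real.Gamma_nat_add_half 2
  norm_num [Nat.doubleFactorial] at h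
  rw [h]
  ring

lemma Gamma_seven_halves : Real.Gamma (7 / 2) = 15 / 8 * √Real.pi := by
  rw [show (7 / 2 : ℝ) = 5 / 2 + 1 by norm_num, Real.Gamma_add_one (by norm_num),
    Gamma_five_halves]
  ring

lemma half_mul_log_le_two_mul_log_Gamma (n : ℕ) :
    (((n : ℝ) + 4) / 2) * Real.log ((((n : ℝ) + 4) / 2 + 2) ^ 2 / 8)
      ≤ 2 * Real.log (Real.Gamma (((n : ℝ) + 4) / 2 + 1)) := by
  -- The functional equation of `Γ` raises `ν` by `1`, that is `d` by `2`, so `d = 4` and `d = 5`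
  -- are both base cases; `d = 4` is an equality.
  induction n using Nat.twoStepInduction with
  | zero =>
    rw [show (((0 : ℕ) : ℝ) + 4) / 2 + 1 = ((2 : ℕ) : ℝ) + 1 by norm_num,
      Real.Gamma_nat_eq_factorial]
    norm_num [Nat.factorial]
  | one =>
    rw [show (((1 : ℕ) : ℝ) + 4) / 2 + 1 = 7 / 2 by norm_num, Gamma_seven_halves]
    have h : Real.log ((81 / 32) ^ 5) ≤ Real.log ((15 / 8 * √Real.pi) ^ 4) := by
      refine Real.log_le_log (by norm_num) ?_
      have h1 : (15 / 8 * √Real.pi) ^ 4 = (15 / 8) ^ 4 * Real.pi ^ 2 := by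
        rw [mul_pow, show √Real.pi ^ 4 = (√Real.pi ^ 2) ^ 2 by ring, Real.sq_sqrt Real.pi_pos.le]
      rw [h1]
      nlinarith [Real.pi_gt_three]
    rw [Real.log_pow, Real.log_pow] at h
    norm_num at h ⊢
    linarith
  | more n ih _ =>
    have hν : (1 : ℝ) ≤ ((n : ℝ) + 4) / 2 := by
      have : (0 : ℝ) ≤ n := Nat.cast_nonneg n
      linarith
    have hpos : 0 < ((n : ℝ) + 4) / 2 + 1 := by positivity
    have hs := mul_log_step hν
    have e : (((n + 2 : ℕ) : ℝ) + 4) / 2 = ((n : ℝ) + 4) / 2 + 1 := by push_cast; ring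
    rw [e, Real.Gamma_add_one hpos.ne', Real.log_mul hpos.ne' (Real.Gamma_pos_of_pos hpos).ne',
      show ((n : ℝ) + 4) / 2 + 1 + 2 = ((n : ℝ) + 4) / 2 + 3 by ring]
    linarith

lemma pow_le_Gamma_pow_four {d : ℕ} (hd : 4 ≤ d) :
    (2 * ((d : ℝ) / 2 + 2) ^ 2) ^ d ≤ 16 ^ d * Real.Gamma ((d : ℝ) / 2 + 1) ^ 4 := by
  obtain ⟨n, rfl⟩ := Nat.exists_eq_add_of_le' hd
  have h := half_mul_log_le_two_mul_log_Gamma n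
  have hG : 0 < Real.Gamma (((n : ℝ) + 4) / 2 + 1) := Real.Gamma_pos_of_pos (by positivity)
  have h2 : (((((n : ℝ) + 4) / 2 + 2) ^ 2 / 8) ^ (n + 4)) ≤
      Real.Gamma (((n : ℝ) + 4) / 2 + 1) ^ 4 := by
    rw [← Real.log_le_log_iff (by positivity) (by positivity), Real.log_pow, Real.log_pow]
    push_cast
    linarith
  push_cast
  calc (2 * (((n : ℝ) + 4) / 2 + 2) ^ 2) ^ (n + 4)
      = 16 ^ (n + 4) * ((((n : ℝ) + 4) / 2 + 2) ^ 2 / 8) ^ (n + 4) := by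
        rw [← mul_pow]
        congr 1
        ring
    _ ≤ _ := by gcongr

/-! ### The main inequality and the constants -/

/-- The main inequality: `j_{d/2,1}^d < 4^d Γ(d/2 + 1)²` for `d ≥ 2`. -/
lemma besselFirstZero_pow_lt {d : ℕ} (hd : 2 ≤ d) :
    IsLeast (besselPosZeros ((d : ℝ) / 2)) (besselFirstZero ((d : ℝ) / 2)) ∧
      besselFirstZero ((d : ℝ) / 2) ^ d < 4 ^ d * Real.Gamma ((d : ℝ) / 2 + 1) ^ 2 := by
  have hν : (0 : ℝ) ≤ (d : ℝ) / 2 := by positivity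
  have hG : 0 < Real.Gamma ((d : ℝ) / 2 + 1) := Real.Gamma_pos_of_pos (by positivity)
  obtain ⟨T, hz, hT⟩ : ∃ T : ℝ, (∃ t ∈ Ioo 0 T, besselEntire ((d : ℝ) / 2) t = 0) ∧
      (4 * T) ^ d ≤ 16 ^ d * Real.Gamma ((d : ℝ) / 2 + 1) ^ 4 := by
    rcases (by omega : d = 2 ∨ d = 3 ∨ 4 ≤ d) with rfl | rfl | h4
    -- `T = 4` is the largest value allowed here; strictness comes from the zero lying in the open
    -- interval.
    · refine ⟨4, exists_besselEntire_eq_zero_of_neg hν (by norm_num) ?_, ?_⟩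
      · norm_num [besselEntire_one_four_neg]
      · norm_num
    · refine ⟨28 / 5, exists_besselEntire_eq_zero_of_neg hν (by norm_num) ?_, ?_⟩
      · simpa using besselEntire_three_halves_neg
      · rw [show ((3 : ℕ) : ℝ) / 2 + 1 = 5 / 2 by norm_num, Gamma_five_halves,
          mul_pow (3 / 4),
          show √Real.pi ^ 4 = (√Real.pi ^ 2) ^ 2 by ring, Real.sq_sqrt Real.pi_pos.le]
        nlinarith [Real.pi_gt_three]
    · refine ⟨_, exists_besselEntire_eq_zero hν, ?_⟩
      convert pow_le_Gamma_pow_four h4 using 2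
      ring
  obtain ⟨hl, hlt⟩ := besselFirstZero_lt_of_exists hν hz
  refine ⟨hl, lt_of_pow_lt_pow_left₀ 2 (by positivity) ?_⟩
  calc (besselFirstZero ((d : ℝ) / 2) ^ d) ^ 2 = (besselFirstZero ((d : ℝ) / 2) ^ 2) ^ d := by ring
    _ < (4 * T) ^ d := pow_lt_pow_left₀ hlt (by positivity) (by omega)
    _ ≤ 16 ^ d * Real.Gamma ((d : ℝ) / 2 + 1) ^ 4 := hT
    _ = _ := by
      rw [mul_pow, ← pow_mul, ← pow_mul, mul_comm d 2, pow_mul]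
      norm_num

lemma alpha_add_one (K : BaseField) {m : ℕ} (hm : 2 ≤ m) :
    alpha K m + 1 = ((K.delta * (m - 1) : ℕ) : ℝ) / 2 := by
  unfold alpha
  push_cast [Nat.cast_sub (show 1 ≤ m by omega)]
  ring

lemma lam_pos (K : BaseField) (m : ℕ) : 0 < lam K m := by
  cases K <;> simp only [lam] <;> positivity

/-- In all three cases the constant is `4^d Γ(d/2 + 1)²` with `d = δ(m-1)`. -/
lemma gamma_mul_lam (K : BaseField) {m : ℕ} (hm : 2 ≤ m) :
    Real.Gamma (alpha K m + 2) * Real.Gamma (beta K + 1) / Real.Gamma (alpha K m + beta K + 2)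
        * lam K m
      = 4 ^ (K.delta * (m - 1)) * Real.Gamma (((K.delta * (m - 1) : ℕ) : ℝ) / 2 + 1) ^ 2 := by
  have ha := alpha_add_one K hm
  rw [show alpha K m + 2 = alpha K m + 1 + 1 by ring,
    show alpha K m + beta K + 2 = alpha K m + 1 + (beta K + 1) by ring, ha]
  obtain ⟨n, rfl⟩ := Nat.exists_eq_add_of_le' (show 1 ≤ m by omega)
  cases K
  · simp only [BaseField.delta, beta, lam, Nat.add_sub_cancel, one_mul]
    -- Over `ℝ` the factorial in `lam` is split by the duplication formula; over `ℂ` and `ℍ` all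
    -- Gamma values are factorials.
    have hg := Real.Gamma_mul_Gamma_add_half ((n : ℝ) / 2 + 1 / 2)
    rw [show (n : ℝ) / 2 + 1 / 2 + 1 / 2 = (n : ℝ) / 2 + 1 by ring,
      show 2 * ((n : ℝ) / 2 + 1 / 2) = (n : ℝ) + 1 by ring, Real.Gamma_nat_eq_factorial,
      show 1 - ((n : ℝ) + 1) = -(n : ℝ) by ring, Real.rpow_neg (by norm_num),
      Real.rpow_natCast] at hg
    have h1 : Real.Gamma ((n : ℝ) / 2 + 1 / 2) ≠ 0 := (Real.Gamma_pos_of_pos (by positivity)).ne'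
    rw [show ((1 : ℕ) - 2 : ℝ) / 2 + 1 = 1 / 2 by norm_num, Real.Gamma_one_half_eq]
    rw [div_mul_eq_mul_div, div_eq_iff h1,
      show (4 : ℝ) ^ n = 2 ^ n * 2 ^ n by rw [← mul_pow]; norm_num]
    have h2 : (2 : ℝ) ^ n * ((2 : ℝ) ^ n)⁻¹ = 1 := mul_inv_cancel₀ (by positivity)
    linear_combination (-(2 : ℝ) ^ n * 2 ^ n * Real.Gamma ((n : ℝ) / 2 + 1)) * hg
      - (√Real.pi * Real.Gamma ((n : ℝ) / 2 + 1) * (n ! : ℝ) * 2 ^ n) * h2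
  · simp only [BaseField.delta, beta, lam, Nat.add_sub_cancel]
    have e : (((2 * n : ℕ) : ℝ)) / 2 = n := by push_cast; ring
    rw [e, show ((2 : ℕ) - 2 : ℝ) / 2 + 1 = 1 by norm_num, Real.Gamma_one,
      Real.Gamma_nat_eq_factorial, pow_mul, pow_mul]
    have : (n ! : ℝ) ≠ 0 := by positivity
    field_simp
    norm_num
  · simp only [BaseField.delta, beta, lam, Nat.add_sub_cancel]
    have e : (((4 * n : ℕ) : ℝ)) / 2 = (2 * n : ℕ) := by push_cast; ring
    rw [e, show ((4 : ℕ) - 2 : ℝ) / 2 + 1 = ((1 : ℕ) : ℝ) + 1 by norm_num,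
      Real.Gamma_nat_eq_factorial, Real.Gamma_nat_eq_factorial,
      show ((2 * n : ℕ) : ℝ) + (((1 : ℕ) : ℝ) + 1) = ((2 * n + 1 : ℕ) : ℝ) + 1 by push_cast; ring,
      Real.Gamma_nat_eq_factorial, show 2 * (n + 1) - 1 = 2 * n + 1 by omega,
      show 2 * (n + 1) - 2 = 2 * n by omega, pow_mul, pow_mul]
    have h1 : ((2 * n + 1) ! : ℝ) ≠ 0 := by positivity
    rw [Nat.factorial_one]
    field_simp
    norm_num

end ProjCubature

theorem proposition5p1 (K : ProjCubature.BaseField) (m : ℕ) (hm : 2 ≤ m) :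
    -- the first positive zero of the Bessel function of order `α + 1` exists
    IsLeast (ProjCubature.besselPosZeros (ProjCubature.alpha K m + 1))
      (ProjCubature.besselFirstZero (ProjCubature.alpha K m + 1)) ∧
    -- strict inequality, and strict comparison of the asymptotic bounds, off the exceptional case
    (¬ (m = 2 ∧ K.delta = 1) →
      ProjCubature.besselFirstZero (ProjCubature.alpha K m + 1) ^ (K.delta * (m - 1)) <
        Real.Gamma (ProjCubature.alpha K m + 2) * Real.Gamma (ProjCubature.beta K + 1) /
          Real.Gamma (ProjCubature.alpha K m + ProjCubature.beta K + 2) *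
            ProjCubature.lam K m ∧
      ∀ p : ℕ, Even p → 0 < p →
        ProjCubature.classicalAsymptoticBound K m p < ProjCubature.newAsymptoticBound K m p) ∧
    -- equality in the exceptional case
    (m = 2 ∧ K.delta = 1 →
      ProjCubature.besselFirstZero (ProjCubature.alpha K m + 1) ^ (K.delta * (m - 1)) =
        Real.Gamma (ProjCubature.alpha K m + 2) * Real.Gamma (ProjCubature.beta K + 1) /
          Real.Gamma (ProjCubature.alpha K m + ProjCubature.beta K + 2) *
            ProjCubature.lam K m ∧
      ∀ p : ℕ, Even p → 0 < p →
        ProjCubature.classicalAsymptoticBound K m p = ProjCubature.newAsymptoticBound K m p) := by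
  have hd : 1 ≤ K.delta := by cases K <;> decide
  have hlam := ProjCubature.lam_pos K m
  simp only [ProjCubature.classicalAsymptoticBound, ProjCubature.newAsymptoticBound,
    ProjCubature.gammaFactor]
  rw [ProjCubature.alpha_add_one K hm]
  have hprod := ProjCubature.gamma_mul_lam K hm
  have hpow : ∀ p : ℕ, 0 < p → (0 : ℝ) < (p : ℝ) ^ (K.delta * (m - 1)) := fun p hp => by positivity
  generalize Real.Gamma (ProjCubature.alpha K m + 2) * Real.Gamma (ProjCubature.beta K + 1) /
    Real.Gamma (ProjCubature.alpha K m + ProjCubature.beta K + 2) = g at hprod ⊢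
  by_cases hex : m = 2 ∧ K.delta = 1
  · have hd1 : K.delta * (m - 1) = 1 := by rw [hex.1, hex.2]
    rw [hd1] at hprod hpow ⊢
    obtain ⟨hl, hpi⟩ := ProjCubature.besselFirstZero_half
    have he : g * ProjCubature.lam K m = Real.pi := by
      rw [hprod, show ((1 : ℕ) : ℝ) / 2 + 1 = 1 / 2 + 1 by norm_num,
        Real.Gamma_add_one (by norm_num), Real.Gamma_one_half_eq, mul_pow,
        Real.sq_sqrt Real.pi_pos.le]
      ring
    rw [Nat.cast_one, hpi]
    refine ⟨hpi ▸ hl, fun h => absurd hex h, fun _ => ⟨by rw [he, pow_one], fun p _ hp => ?_⟩⟩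
    rw [mul_div_assoc', div_eq_div_iff hlam.ne' (by positivity), pow_one Real.pi, ← he]
    ring
  · have hd2 : 2 ≤ K.delta * (m - 1) := by
      by_contra! h
      have h1 : K.delta * (m - 1) = 1 := by
        have := Nat.mul_pos hd (show 0 < m - 1 by omega)
        omega
      obtain ⟨h2, h3⟩ := mul_eq_one.1 h1
      exact hex ⟨by omega, h2⟩
    obtain ⟨hl, hlt⟩ := ProjCubature.besselFirstZero_pow_lt hd2
    rw [← hprod] at hlt
    refine ⟨hl, fun _ => ⟨hlt, fun p _ hp => ?_⟩, fun h => absurd h hex⟩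
    have hj := pow_pos hl.1.1 (K.delta * (m - 1))
    rw [mul_div_assoc', div_lt_div_iff₀ hlam hj]
    have := mul_lt_mul_of_pos_left hlt (hpow p hp)
    linarith
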